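/- Let $G=(V,E,\kappa)$ be a finite simple connected graph with symmetric weights $\kappa\colon V\times V\to[0,1]$ such that $\kappa(v,w)=0$ exactly when $(v,w)\notin E$. Let $d_E$ be the weighted shortest-path metric on $V$ and $\delta$ its subdominant ultrametric, i.e. the largest ultrametric $\le d_E$. Fix $\alpha\ge 1$ and a choice $\bullet\in\{\kappa,d_E,\delta\}$. For $v\ne w$ put $k_\bullet(v,w)=\bullet(v,w)^{-\alpha}$, with $k_\kappa(v,w)=0$ if $(v,w)\notin E$. Let $p$ be a prime. Represent the vertices by pairwise disjoint discs $U_v\subset\mathbb Z_p$ of radius $p^{-N_v}$ with $N_v\in\mathbb N$, let $Z=\bigsqcup_v U_v$, and fix $\alpha_v>0$ for $v\in V$. Put $k_\bullet(x,y)=|x-y|_p^{-\alpha_v}$ for $x,y\in U_v$, and $k_\bullet(x,y)=k_\bullet(v,w)$ for $x\in U_v$, $y\in U_w$, $v\neq w$. Let $\nu$ be one of the following two measures on $Z$: the restricted normalised Haar measure of $\mathbb Z_p$; or the measure of total mass $1$ obtained from the tree of $\delta$-balls in $V$ (with leaves the vertices) by dividing the mass of each node equally among its child nodes and spreading the mass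 of a leaf $v$ uniformly over $U_v$. On $X=C(Z,\mathbb R)$ with the sup norm consider $$\mathcal H_\bullet f(x)=\int_Z k_\bullet(x,y)\,(f(y)-f(x))\,d\nu(y).$$ For $n>\max_v N_v$ let $v_n$ and $Z_n=\bigsqcup_v v_n\subset\mathbb Z_p/p^n\mathbb Z_p$ be the sets of classes $[x]_n$ with $x\in U_v$ and $x\in Z$, respectively. Let $\nu_n$ be the image of $\nu$ on $Z_n$ and $X_n$ the space of functions $Z_n\to\mathbb R$, and put $$\mathcal H_\bullet^{(n)}g(a)=\int_{Z_n}k_n(a,b)\,(g(b)-g(a))\,d\nu_n(b),$$ where $k_n(a,b)=|a-b|_p^{-\alpha_v}$ for $a\ne b$ in $v_n$, $k_n(a,a)=0$, and $k_n(a,b)=k_\bullet(v,w)$ for $a\in v_n$, $b\in w_n$, $v\ne w$. Fix a representative $x_n\in Z$ of each class $[x]_n\in Z_n$, and put $E_ng(x)=g([x]_n)$ for $g\in X_n$ and $P_nf([x]_n)=f(x_n)$ for $f\in X$. Let $u_0\in X$, and let $u$ be a solution of the Cauchy problem $$\frac{\partial}{\partial t}u(x,t)-\mathcal H_\bullet u(x,t)=0,\qquad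 u(x,0)=u_0(x),$$ that is, $t\mapsto u(\cdot,t)\in X$ is continuous on $[0,\infty)$, and for all $t>0$ and $x\in Z$ the integral defining $\mathcal H_\bullet u(x,t)$ converges absolutely and the equation holds. For $n>\max_v N_v$ let $u_n$ be a solution, with values in $X_n$, of $$\frac{\partial}{\partial t}u_n([x]_n,t)-\mathcal H_\bullet^{(n)}u_n([x]_n,t)=0,\qquad u_n([x]_n,0)=P_nu_0([x]_n).$$ Then for every $\tau\ge 0$ $$\lim_{n\to\infty}\ \sup_{0\le t\le\tau}\ \lVert E_nu_n(\cdot,t)-u(\cdot,t)\rVert_\infty=0 .$$ -/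

import Mathlib

open MeasureTheory Filter Topology
open scoped ENNReal NNReal

namespace PadicGraph

/-! ### Weighted graphs and the three kinds of vertex kernels -/

/-- A simple connected graph with a weight `κ : V × V → [0,1]` that vanishes exactly off the
edges. -/
structure WeightedGraph (V : Type*) where
  graph : SimpleGraph V
  connected : graph.Connected
  weight : V → V → ℝ
  weight_mem : ∀ v w, weight v w ∈ Set.Icc (0 : ℝ) 1
  weight_symm : ∀ v w, weight v w = weight w v
  weight_eq_zero_iff : ∀ v w, weight v w = 0 ↔ ¬ graph.Adj v w

/-- `ρ` is an ultrametric on the set `V`. -/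
structure IsUltrametric {V : Type*} (ρ : V → V → ℝ) : Prop where
  nonneg : ∀ x y, 0 ≤ ρ x y
  eq_zero_iff : ∀ x y, ρ x y = 0 ↔ x = y
  symm : ∀ x y, ρ x y = ρ y x
  strong_triangle : ∀ x y z, ρ x z ≤ max (ρ x y) (ρ y z)

namespace WeightedGraph

variable {V : Type*} (G : WeightedGraph V)

/-- The length of a walk: the sum of the weights of its edges. -/
def walkLength {v w : V} (q : G.graph.Walk v w) : ℝ :=
  (q.darts.map fun e => G.weight e.fst e.snd).sum

/-- The shortest-path metric `d_E` of the weighted graph. -/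
noncomputable def pathDist (v w : V) : ℝ := ⨅ q : G.graph.Walk v w, G.walkLength q

/-- The subdominant ultrametric `δ` of `d_E`: the largest ultrametric that is `≤ d_E`. -/
noncomputable def subdominant (v w : V) : ℝ :=
  sSup {r : ℝ | ∃ ρ : V → V → ℝ, IsUltrametric ρ ∧ (∀ x y, ρ x y ≤ G.pathDist x y) ∧ r = ρ v w}

end WeightedGraph

/-- The three choices `κ`, `d_E`, `δ` for the bullet in `H_•`. -/
inductive Bullet
  | adjacency
  | pathDistance
  | ultrametric

open Classical in
/-- The transition rate `k(v, w)` between two different vertices. -/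
noncomputable def WeightedGraph.rate {V : Type*} (G : WeightedGraph V) (α : ℝ) :
    Bullet → V → V → ℝ
  | .adjacency, v, w => if G.graph.Adj v w then G.weight v w ^ (-α) else 0
  | .pathDistance, v, w => G.pathDist v w ^ (-α)
  | .ultrametric, v, w => G.subdominant v w ^ (-α)

/-! ### The tree of the subdominant ultrametric, and the masses it gives to the vertices -/

namespace WeightedGraph

variable {V : Type*} [Fintype V] (G : WeightedGraph V)

open Classical in
/-- The nodes of the tree `T^δ`: the balls `{w | δ(v,w) ≤ r}`, `r ≥ 0`. -/
noncomputable def nodes : Finset (Finset V) :=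
  Finset.univ.filter fun s => ∃ (v : V) (r : ℝ), 0 ≤ r ∧ ∀ w, w ∈ s ↔ G.subdominant v w ≤ r

open Classical in
/-- The child nodes of a node: the maximal nodes strictly contained in it. -/
noncomputable def children (s : Finset V) : Finset (Finset V) :=
  G.nodes.filter fun c => c ⊂ s ∧ ∀ d ∈ G.nodes, c ⊂ d → ¬ d ⊂ s

open Classical in
/-- The root has mass `1`, and every node divides its mass equally among its child nodes; this is
the mass of the leaf `{v}`. -/
noncomputable def treeMass (v : V) : ℝ≥0 :=
  ∏ s ∈ G.nodes.filter (fun s => v ∈ s ∧ s ≠ {v}), ((G.children s).card : ℝ≥0)⁻¹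

end WeightedGraph

/-! ### Haar measure on the `p`-adic integers -/

section

variable (p : ℕ) [Fact p.Prime]

noncomputable instance : MeasurableSpace ℤ_[p] := borel _

instance : BorelSpace ℤ_[p] := ⟨rfl⟩

/-- Haar measure on `ℤ_p`, normalised by `μ(ℤ_p) = 1`. -/
noncomputable def haar : Measure ℤ_[p] := Measure.addHaarMeasure ⊤

end

/-! ### Vertices as disjoint `p`-adic discs -/

/-- A representation of the vertices by pairwise disjoint discs in `ℤ_p`; the disc of `v` has
centre `center v` and radius `p ^ (-level v)`. -/
structure VertexDiscs (p : ℕ) [Fact p.Prime] (V : Type*) where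
  center : V → ℤ_[p]
  level : V → ℕ
  disjoint : Pairwise fun v w =>
    Disjoint (Metric.closedBall (center v) ((p : ℝ) ^ (-(level v : ℤ))))
      (Metric.closedBall (center w) ((p : ℝ) ^ (-(level w : ℤ))))

namespace VertexDiscs

variable {p : ℕ} [Fact p.Prime] {V : Type*} (D : VertexDiscs p V)

/-- The disc `U_v`. -/
noncomputable def disc (v : V) : Set ℤ_[p] := Metric.closedBall (D.center v) ((p : ℝ) ^ (-(D.level v : ℤ)))

/-- The space `Z`, the disjoint union of the discs `U_v`. -/
noncomputable def Z : Set ℤ_[p] := ⋃ v, D.disc v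

instance [Fintype V] : CompactSpace D.Z :=
  isCompact_iff_compactSpace.mp
    (isClosed_iUnion_of_finite fun _ => Metric.isClosed_closedBall).isCompact

open Classical in
/-- The kernel on `ℤ_p × ℤ_p`: it is `|x-y|_p ^ (-α_v)` if `x` and `y` lie in the same disc `U_v`,
it is `k(v,w)` if they lie in the discs of different vertices `v`, `w`, and `0` if one of them lies
in no disc. As the discs are disjoint, at most one summand is non-zero. -/
noncomputable def kernel [Fintype V] (k : V → V → ℝ) (β : V → ℝ) (x y : ℤ_[p]) : ℝ :=
  ∑ v, ∑ w, if x ∈ D.disc v ∧ y ∈ D.disc w then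
    (if v = w then ‖x - y‖ ^ (-β v) else k v w) else 0

end VertexDiscs

/-- The two reference measures: Haar measure `dx`, and the measure `ν` of the ultrametric tree. -/
inductive RefMeasure
  | haar
  | tree

namespace VertexDiscs

variable {p : ℕ} [Fact p.Prime] {V : Type*} [Fintype V] (D : VertexDiscs p V)

/-- The reference measure as a measure on `ℤ_p`. In the second case `U_v` has the mass of the leaf
`v`, spread uniformly over the disc. -/
noncomputable def ambientMeasure (G : WeightedGraph V) : RefMeasure → Measure ℤ_[p]
  | .haar => (PadicGraph.haar p).restrict D.Z
  | .tree => ∑ v, (G.treeMass v / (PadicGraph.haar p (D.disc v)).toNNReal) •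
      (PadicGraph.haar p).restrict (D.disc v)

/-- The reference measure on the space `Z`. -/
noncomputable def measure (G : WeightedGraph V) (m : RefMeasure) : Measure D.Z :=
  (D.ambientMeasure G m).comap Subtype.val

/-! ### The operator `H_•` and its Cauchy problem -/

/-- `(H f)(x) = ∫_Z k(x,y) (f(y) - f(x)) dν(y)`. -/
noncomputable def laplacian (ν : Measure D.Z) (k : V → V → ℝ) (β : V → ℝ) (f : C(D.Z, ℝ))
    (x : D.Z) : ℝ :=
  ∫ y : D.Z, D.kernel k β x y * (f y - f x) ∂ν

/-- `u` is a solution in `X = C(Z)` of the Cauchy problem `∂u/∂t - H u = 0`, `u(·,0) = u₀`: it is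
continuous from `[0,∞)` to `X`, and for `t > 0` the integral that defines `H u` converges absolutely
and the heat equation holds at every point of `Z`. -/
structure IsHeatSolution (ν : Measure D.Z) (k : V → V → ℝ) (β : V → ℝ) (u₀ : C(D.Z, ℝ))
    (u : ℝ → C(D.Z, ℝ)) : Prop where
  continuousOn : ContinuousOn u (Set.Ici 0)
  initial : u 0 = u₀
  integrable : ∀ t, 0 < t → ∀ x : D.Z,
    Integrable (fun y : D.Z => D.kernel k β x y * (u t y - u t x)) ν
  hasDerivAt : ∀ t, 0 < t → ∀ x : D.Z,
    HasDerivAt (fun s => u s x) (D.laplacian ν k β (u t) x) t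

/-! ### Discretisation modulo `p ^ n` -/

/-- The finite set `v_n ⊆ ℤ/p^n` of the classes of the points of the disc `U_v`. -/
noncomputable def discMod (n : ℕ) (v : V) : Set (ZMod (p ^ n)) := PadicInt.toZModPow n '' D.disc v

/-- The finite set `Z_n` of the classes of the points of `Z`. -/
noncomputable def residues (n : ℕ) : Set (ZMod (p ^ n)) := PadicInt.toZModPow n '' D.Z

/-- The class `[x]_n` of a point of `Z`. -/
noncomputable def cls (n : ℕ) (x : D.Z) : D.residues n := ⟨PadicInt.toZModPow n (x : ℤ_[p]), x, x.2, rfl⟩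

noncomputable instance (n : ℕ) : Fintype (D.residues n) :=
  haveI : NeZero (p ^ n) := ⟨pow_ne_zero n (Fact.out : p.Prime).ne_zero⟩
  Fintype.ofFinite _

/-- The `p`-adic absolute value `|a - b|_p` of two different classes modulo `p ^ n`, computed with
the representatives in `{0, …, p ^ n - 1}`; it does not depend on the choice of representatives. -/
noncomputable def classDist {n : ℕ} (a b : ZMod (p ^ n)) : ℝ :=
  ‖(a.val : ℤ_[p]) - (b.val : ℤ_[p])‖

open Classical in
/-- The discrete kernel: `|a-b|_p ^ (-α_v)` for `a ≠ b` in the same `v_n`, `0` for `a = b`, and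
`k(v,w)` for `a ∈ v_n`, `b ∈ w_n` with `v ≠ w`. -/
noncomputable def kernelMod (n : ℕ) (k : V → V → ℝ) (β : V → ℝ) (a b : ZMod (p ^ n)) : ℝ :=
  ∑ v, ∑ w, if a ∈ D.discMod n v ∧ b ∈ D.discMod n w then
    (if v = w then (if a = b then 0 else classDist a b ^ (-β v)) else k v w) else 0

/-- `(H^{(n)} g)(a) = ∫_{Z_n} k_n(a,b) (g(b) - g(a)) dν_n(b)`, where `ν_n` is the image of `ν`. -/
noncomputable def laplacianMod (ν : Measure D.Z) (k : V → V → ℝ) (β : V → ℝ) (n : ℕ)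
    (g : D.residues n → ℝ) (a : D.residues n) : ℝ :=
  ∑ b : D.residues n, D.kernelMod n k β a b * (g b - g a) * ν.real {y | D.cls n y = b}

/-- `g` solves in `X_n` the Cauchy problem `∂g/∂t - H^{(n)} g = 0`, `g(·,0) = g₀`. -/
structure IsHeatSolutionMod (ν : Measure D.Z) (k : V → V → ℝ) (β : V → ℝ) (n : ℕ)
    (g₀ : D.residues n → ℝ) (g : ℝ → D.residues n → ℝ) : Prop where
  continuousOn : ContinuousOn g (Set.Ici 0)
  initial : g 0 = g₀
  hasDerivAt : ∀ t, 0 < t → ∀ a : D.residues n,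
    HasDerivAt (fun s => g s a) (D.laplacianMod ν k β n (g t) a) t

/-- The projection `P_n : X → X_n`, `(P_n f)([x]_n) = f(x_n)`, with `x_n = rep [x]_n`. -/
noncomputable def proj {n : ℕ} (rep : D.residues n → D.Z) (f : C(D.Z, ℝ)) : D.residues n → ℝ := fun a => f (rep a)

/-- The embedding `E_n : X_n → X`, `(E_n g)(x) = g([x]_n)`. -/
noncomputable def embed (n : ℕ) (g : D.residues n → ℝ) : C(D.Z, ℝ) where
  toFun x := g (D.cls n x)
  continuous_toFun := by
    refine IsLocallyConstant.continuous
      (IsLocallyConstant.iff_eventually_eq _ |>.2 fun x => ?_)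
    have hp : (0 : ℝ) < (p : ℝ) ^ (-(n : ℤ)) :=
      zpow_pos (by exact_mod_cast (Fact.out : p.Prime).pos) _
    filter_upwards [Metric.ball_mem_nhds x hp] with y hy
    congr 1
    apply Subtype.ext
    change PadicInt.toZModPow n (y : ℤ_[p]) = PadicInt.toZModPow n (x : ℤ_[p])
    rw [← sub_eq_zero, ← map_sub, ← RingHom.mem_ker, PadicInt.ker_toZModPow,
      ← PadicInt.norm_le_pow_iff_mem_span_pow, ← dist_eq_norm]
    exact (Metric.mem_ball.1 hy).le

end VertexDiscs

end PadicGraph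

/-! The discrete problem is the continuous one restricted to functions of the residue class. Once
`n` exceeds all levels, `H` preserves functions that are constant on classes mod `p ^ n` and acts on
them as `H^{(n)}` (`laplacian_embed`), because the singular kernel is always multiplied by a
difference that vanishes inside a class. Hence `E_n u_n` solves the Cauchy problem on `C(Z)`
exactly, with initial value `E_n P_n u₀`. Since the kernel is non-negative, a maximum principle
(`heat_le_of_initial_le`) makes two solutions differ at any time by at most their initial sup
distance. The error is thus at most `‖E_n P_n u₀ - u₀‖`, uniformly in time, and this tends to `0` by
uniform continuity of `u₀`. No semigroup theory is needed. -/

namespace PadicGraph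

/-! ### Maximum principle for heat equations with a non-negative kernel -/

/-- A curve of continuous functions on a compact space that solves, for positive times, the heat
equation of a non-negative kernel does not exceed the maximum of its initial value. -/
theorem heat_le_of_initial_le {X : Type*} [TopologicalSpace X] [CompactSpace X]
    [MeasurableSpace X] (ν : Measure X) (K : X → X → ℝ) (hK : ∀ x y, 0 ≤ K x y)
    (w : ℝ → C(X, ℝ)) (hw : ContinuousOn w (Set.Ici 0))
    (hd : ∀ t, 0 < t → ∀ x, HasDerivAt (fun s => w s x) (∫ y, K x y * (w t y - w t x) ∂ν) t)
    (M : ℝ) (hM : ∀ x, w 0 x ≤ M) (t : ℝ) (ht : 0 ≤ t) (x : X) : w t x ≤ M := by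
  -- The tilt `-η s` forces the time derivative at a maximum at a positive time to be at least `η >
  -- 0`, while the integral there is non-positive.
  have key : ∀ η : ℝ, 0 < η → w t x ≤ M + η * t := by
    intro η hη
    have hc : ContinuousOn (fun q : ℝ × X => w q.1 q.2 - η * q.1)
        (Set.Icc 0 t ×ˢ (Set.univ : Set X)) := by
      have h1 : ContinuousOn (fun q : ℝ × X => w q.1) (Set.Icc 0 t ×ˢ (Set.univ : Set X)) :=
        hw.comp continuousOn_fst fun q hq => hq.1.1
      have h2 : ContinuousOn (fun q : ℝ × X => w q.1 q.2)
          (Set.Icc 0 t ×ˢ (Set.univ : Set X)) :=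
        continuous_eval.comp_continuousOn (h1.prodMk continuousOn_snd)
      exact h2.sub (by fun_prop)
    obtain ⟨⟨s, z⟩, hsz, hmax⟩ := (isCompact_Icc.prod isCompact_univ).exists_isMaxOn
      ⟨(t, x), ⟨ht, le_rfl⟩, trivial⟩ hc
    have hle : ∀ r ∈ Set.Icc (0 : ℝ) t, ∀ y, w r y - η * r ≤ w s z - η * s :=
      fun r hr y => hmax (show (r, y) ∈ Set.Icc 0 t ×ˢ (Set.univ : Set X) from ⟨hr, trivial⟩)
    have hs : s ∈ Set.Icc 0 t := hsz.1
    rcases hs.1.eq_or_lt with h0 | h0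
    · have := hle t ⟨ht, le_rfl⟩ x
      subst h0
      linarith [hM z]
    · exfalso
      -- Integrability is not needed here: the default value `0` of the integral also satisfies the
      -- bound.
      have hneg : ∫ y, K z y * (w s y - w s z) ∂ν ≤ 0 :=
        integral_nonpos fun y => mul_nonpos_of_nonneg_of_nonpos (hK z y)
          (by linarith [hle s hs y])
      -- Left difference quotients only, as the maximum may sit at the final time `s = t`.
      have hder := (hd s h0 z).hasDerivWithinAt (s := Set.Iio s)
      rw [hasDerivWithinAt_iff_tendsto_slope' (by simp)] at hder
      have hge : η ≤ ∫ y, K z y * (w s y - w s z) ∂ν := by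
        refine ge_of_tendsto hder ?_
        filter_upwards [Ioo_mem_nhdsLT h0] with r hr
        rw [slope_def_field, le_div_iff_of_neg (by linarith [hr.2])]
        linarith [hle r ⟨hr.1.le, hr.2.le.trans hs.2⟩ z]
      linarith
  -- The denominator `t + 1` avoids dividing by zero at `t = 0`.
  refine le_of_forall_pos_le_add fun ε hε => (key (ε / (t + 1)) (by positivity)).trans ?_
  have : ε / (t + 1) * t ≤ ε := by
    rw [div_mul_eq_mul_div, div_le_iff₀ (by linarith)]
    nlinarith
  linarith

/-! ### Non-negativity of the rates and of the kernel -/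

namespace WeightedGraph

variable {V : Type*} (G : WeightedGraph V)

theorem pathDist_nonneg (v w : V) : 0 ≤ G.pathDist v w := by
  refine Real.iInf_nonneg fun q => List.sum_nonneg ?_
  simp only [List.mem_map]
  rintro _ ⟨e, -, rfl⟩
  exact (G.weight_mem _ _).1

theorem subdominant_nonneg (v w : V) : 0 ≤ G.subdominant v w := by
  refine Real.sSup_nonneg ?_
  rintro _ ⟨ρ, hρ, -, rfl⟩
  exact hρ.nonneg v w

theorem rate_nonneg (α : ℝ) (bullet : Bullet) (v w : V) : 0 ≤ G.rate α bullet v w := by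
  cases bullet
  · simp only [rate]
    split_ifs
    · exact Real.rpow_nonneg (G.weight_mem v w).1 _
    · exact le_rfl
  · exact Real.rpow_nonneg (G.pathDist_nonneg v w) _
  · exact Real.rpow_nonneg (G.subdominant_nonneg v w) _

end WeightedGraph

/-! ### Residue classes and discs -/

section

variable {p : ℕ} [Fact p.Prime]

theorem toZModPow_eq_iff_norm_sub_le (n : ℕ) (x y : ℤ_[p]) :
    PadicInt.toZModPow n x = PadicInt.toZModPow n y ↔ ‖x - y‖ ≤ (p : ℝ) ^ (-(n : ℤ)) := by
  rw [← sub_eq_zero, ← map_sub, ← RingHom.mem_ker, PadicInt.ker_toZModPow,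
    ← PadicInt.norm_le_pow_iff_mem_span_pow]

theorem toZModPow_natCast_val (n : ℕ) (a : ZMod (p ^ n)) :
    PadicInt.toZModPow n ((a.val : ℕ) : ℤ_[p]) = a := by
  have : NeZero (p ^ n) := ⟨pow_ne_zero n (Fact.out : p.Prime).ne_zero⟩
  rw [map_natCast, ZMod.natCast_zmod_val]

theorem norm_eq_of_norm_sub_le {r : ℝ} {a b : ℤ_[p]} (h : ‖a - b‖ ≤ r) (hb : r < ‖b‖) :
    ‖a‖ = ‖b‖ := by
  have hlt : ‖a - b‖ < ‖b‖ := h.trans_lt hb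
  have := PadicInt.norm_add_eq_max_of_ne hlt.ne
  rwa [sub_add_cancel, max_eq_right hlt.le] at this

/-- Changing representatives alters the difference by at most `p ^ (-n)`, which is less than `‖x -
y‖` for distinct classes, so the ultrametric inequality preserves the norm. -/
theorem classDist_toZModPow {n : ℕ} {x y : ℤ_[p]}
    (h : PadicInt.toZModPow n x ≠ PadicInt.toZModPow n y) :
    VertexDiscs.classDist (PadicInt.toZModPow n x) (PadicInt.toZModPow n y) = ‖x - y‖ := by
  have hxy : (p : ℝ) ^ (-(n : ℤ)) < ‖x - y‖ := by
    rwa [Ne, toZModPow_eq_iff_norm_sub_le, not_le] at h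
  refine norm_eq_of_norm_sub_le ?_ hxy
  rw [← toZModPow_eq_iff_norm_sub_le, map_sub, map_sub, toZModPow_natCast_val,
    toZModPow_natCast_val]

end

/-! ### Reduction mod `p ^ n`, intertwining, contraction and approximation -/

namespace VertexDiscs

variable {p : ℕ} [Fact p.Prime] {V : Type*} (D : VertexDiscs p V)

/-- A disc of level at most `n` is a union of full classes mod `p ^ n`. -/
theorem toZModPow_mem_discMod_iff {n : ℕ} {v : V} (hn : D.level v ≤ n) (x : ℤ_[p]) :
    PadicInt.toZModPow n x ∈ D.discMod n v ↔ x ∈ D.disc v := by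
  refine ⟨?_, fun hx => ⟨x, hx, rfl⟩⟩
  rintro ⟨y, hy, hyx⟩
  have hpp : (1 : ℝ) ≤ p := by exact_mod_cast (Fact.out : p.Prime).one_lt.le
  have h1 : ‖x - y‖ ≤ (p : ℝ) ^ (-(D.level v : ℤ)) :=
    ((toZModPow_eq_iff_norm_sub_le n x y).1 hyx.symm).trans
      (zpow_le_zpow_right₀ hpp (by omega))
  simp only [disc, Metric.mem_closedBall, dist_eq_norm] at hy ⊢
  rw [← sub_add_sub_cancel x y]
  exact (PadicInt.nonarchimedean _ _).trans (max_le h1 hy)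

theorem cls_eq_iff (n : ℕ) (x y : D.Z) :
    D.cls n x = D.cls n y ↔ dist x y ≤ (p : ℝ) ^ (-(n : ℤ)) := by
  rw [Subtype.dist_eq, dist_eq_norm, ← toZModPow_eq_iff_norm_sub_le, Subtype.ext_iff]
  rfl

theorem measurableSet_cls_fiber (n : ℕ) (b : D.residues n) :
    MeasurableSet {y : D.Z | D.cls n y = b} := by
  obtain ⟨_, x, hx, rfl⟩ := b
  have : {y : D.Z | D.cls n y = D.cls n ⟨x, hx⟩} =
      Metric.closedBall ⟨x, hx⟩ ((p : ℝ) ^ (-(n : ℤ))) := by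
    ext y
    exact D.cls_eq_iff n y _
  exact this ▸ Metric.isClosed_closedBall.measurableSet

theorem integrable_and_integral_cls (ν : Measure D.Z) [IsFiniteMeasure ν] (n : ℕ) (F : D.residues n → ℝ) :
    Integrable (fun y => F (D.cls n y)) ν ∧
      ∫ y, F (D.cls n y) ∂ν = ∑ b, F b * ν.real {y | D.cls n y = b} := by
  classical
  have hF : (fun y => F (D.cls n y)) =
      fun y => ∑ b, Set.indicator {y | D.cls n y = b} (fun _ => F b) y := by
    ext y
    simp [Set.indicator_apply]
  have hi : ∀ b : D.residues n,
      Integrable (Set.indicator {y | D.cls n y = b} (fun _ => F b)) ν :=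
    fun b => (integrable_const (F b)).indicator (D.measurableSet_cls_fiber n b)
  rw [hF]
  refine ⟨integrable_finsetSum _ fun b _ => hi b, ?_⟩
  rw [integral_finsetSum _ fun b _ => hi b]
  refine Finset.sum_congr rfl fun b _ => ?_
  rw [integral_indicator_const _ (D.measurableSet_cls_fiber n b), smul_eq_mul, mul_comm]

variable [Fintype V]

theorem kernel_nonneg {k : V → V → ℝ} (hk : ∀ v w, 0 ≤ k v w) (β : V → ℝ) (x y : ℤ_[p]) :
    0 ≤ D.kernel k β x y := by
  refine Finset.sum_nonneg fun v _ => Finset.sum_nonneg fun w _ => ?_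
  split_ifs
  · positivity
  · exact hk v w
  · exact le_rfl

/-- On functions of the residue class the two kernels agree. -/
theorem kernel_mul_cls {n : ℕ} (hn : ∀ v, D.level v < n) (k : V → V → ℝ) (β : V → ℝ)
    (g : D.residues n → ℝ) (x y : D.Z) :
    D.kernel k β x y * (g (D.cls n y) - g (D.cls n x)) =
      D.kernelMod n k β (D.cls n x) (D.cls n y) * (g (D.cls n y) - g (D.cls n x)) := by
  classical
  by_cases h : D.cls n x = D.cls n y
  -- Within one class both products vanish, whatever the kernels are; this absorbs the singularity.
  · simp [h]
  · have hne : PadicInt.toZModPow n (x : ℤ_[p]) ≠ PadicInt.toZModPow n (y : ℤ_[p]) :=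
      fun e => h (Subtype.ext e)
    congr 1
    refine Finset.sum_congr rfl fun v _ => Finset.sum_congr rfl fun w _ => ?_
    refine if_congr (and_congr (D.toZModPow_mem_discMod_iff (hn v).le x).symm
      (D.toZModPow_mem_discMod_iff (hn w).le y).symm) ?_ rfl
    simp only [cls, if_neg hne, classDist_toZModPow hne]

instance (G : WeightedGraph V) (m : RefMeasure) : IsFiniteMeasure (D.ambientMeasure G m) := by
  have : IsFiniteMeasure (PadicGraph.haar p) := by
    unfold PadicGraph.haar
    infer_instance
  cases m <;> unfold ambientMeasure <;> infer_instance

instance (G : WeightedGraph V) (m : RefMeasure) : IsFiniteMeasure (D.measure G m) := by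
  have hZ : MeasurableSet D.Z :=
    (isClosed_iUnion_of_finite fun _ => Metric.isClosed_closedBall).measurableSet
  refine ⟨?_⟩
  rw [measure, (MeasurableEmbedding.subtype_coe hZ).comap_apply]
  exact measure_lt_top _ _

theorem integrable_kernel_embed (ν : Measure D.Z) [IsFiniteMeasure ν] {n : ℕ}
    (hn : ∀ v, D.level v < n) (k : V → V → ℝ) (β : V → ℝ) (g : D.residues n → ℝ) (x : D.Z) :
    Integrable (fun y : D.Z => D.kernel k β x y * (D.embed n g y - D.embed n g x)) ν := by
  have h := (D.integrable_and_integral_cls ν n fun b =>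
    D.kernelMod n k β (D.cls n x) b * (g b - g (D.cls n x))).1
  exact h.congr (ae_of_all _ fun y => (D.kernel_mul_cls hn k β g x y).symm)

/-- The embedding intertwines the discrete operator with the operator on `C(Z)`. -/
theorem laplacian_embed (ν : Measure D.Z) [IsFiniteMeasure ν] {n : ℕ}
    (hn : ∀ v, D.level v < n) (k : V → V → ℝ) (β : V → ℝ) (g : D.residues n → ℝ) (x : D.Z) :
    D.laplacian ν k β (D.embed n g) x = D.laplacianMod ν k β n g (D.cls n x) := by
  rw [laplacianMod, ← (D.integrable_and_integral_cls ν n fun b =>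
    D.kernelMod n k β (D.cls n x) b * (g b - g (D.cls n x))).2]
  exact integral_congr_ae (ae_of_all _ fun y => D.kernel_mul_cls hn k β g x y)

theorem continuous_embed (n : ℕ) : Continuous (D.embed n) := by
  refine (LipschitzWith.of_dist_le_mul (K := 1) fun g h => ?_).continuous
  rw [NNReal.coe_one, one_mul, ContinuousMap.dist_le dist_nonneg]
  exact fun x => dist_le_pi_dist g h (D.cls n x)

/-- Solutions of the discrete problem are solutions of the problem on `C(Z)`. -/
theorem IsHeatSolutionMod.embed {ν : Measure D.Z} [IsFiniteMeasure ν] {k : V → V → ℝ}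
    {β : V → ℝ} {n : ℕ} (hn : ∀ v, D.level v < n) {g₀ : D.residues n → ℝ}
    {g : ℝ → D.residues n → ℝ} (hg : D.IsHeatSolutionMod ν k β n g₀ g) :
    D.IsHeatSolution ν k β (D.embed n g₀) (fun t => D.embed n (g t)) where
  continuousOn := (D.continuous_embed n).comp_continuousOn hg.continuousOn
  initial := by rw [hg.initial]
  integrable t _ x := D.integrable_kernel_embed ν hn k β (g t) x
  hasDerivAt t ht x := by
    rw [D.laplacian_embed ν hn]
    exact hg.hasDerivAt t ht (D.cls n x)

variable {D}

theorem IsHeatSolution.sub_le {ν : Measure D.Z} {k : V → V → ℝ} (hk : ∀ v w, 0 ≤ k v w)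
    {β : V → ℝ} {u₀ w₀ : C(D.Z, ℝ)} {u w : ℝ → C(D.Z, ℝ)} (hu : D.IsHeatSolution ν k β u₀ u)
    (hw : D.IsHeatSolution ν k β w₀ w) {t : ℝ} (ht : 0 ≤ t) (x : D.Z) :
    u t x - w t x ≤ ‖u₀ - w₀‖ := by
  refine heat_le_of_initial_le ν (fun x y => D.kernel k β x y)
    (fun x y => D.kernel_nonneg hk β x y) (fun s => u s - w s)
    (hu.continuousOn.sub hw.continuousOn) (fun s hs y => ?_) ‖u₀ - w₀‖ (fun y => ?_) t ht x
  · have h := (hu.hasDerivAt s hs y).sub (hw.hasDerivAt s hs y)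
    -- Absolute convergence for both solutions is what lets the integrals be subtracted.
    rw [laplacian, laplacian, ← integral_sub (hu.integrable s hs y) (hw.integrable s hs y)] at h
    refine h.congr_deriv (integral_congr_ae (ae_of_all _ fun z => ?_))
    simp only [ContinuousMap.sub_apply]
    ring
  · simp only [hu.initial, hw.initial]
    exact (le_abs_self _).trans ((u₀ - w₀).norm_coe_le_norm y)

/-- The heat equation is contractive for the sup norm. -/
theorem IsHeatSolution.norm_sub_le {ν : Measure D.Z} {k : V → V → ℝ} (hk : ∀ v w, 0 ≤ k v w)
    {β : V → ℝ} {u₀ w₀ : C(D.Z, ℝ)} {u w : ℝ → C(D.Z, ℝ)} (hu : D.IsHeatSolution ν k β u₀ u)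
    (hw : D.IsHeatSolution ν k β w₀ w) {t : ℝ} (ht : 0 ≤ t) :
    ‖u t - w t‖ ≤ ‖u₀ - w₀‖ := by
  refine (ContinuousMap.norm_le _ (norm_nonneg _)).2 fun x => abs_le.2 ⟨?_, hu.sub_le hk hw ht x⟩
  have := hw.sub_le hk hu ht x
  rw [norm_sub_rev] at this
  rw [ContinuousMap.sub_apply]
  linarith

variable (D)

/-- Each point is within `p ^ (-n)` of the representative of its class, and `f` is uniformly
continuous on the compact space `Z`. -/
theorem tendsto_embed_proj (f : C(D.Z, ℝ)) (rep : ∀ n, D.residues n → D.Z)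
    (hrep : ∀ n a, D.cls n (rep n a) = a) :
    Tendsto (fun n => D.embed n (D.proj (rep n) f)) atTop (𝓝 f) := by
  rw [Metric.tendsto_atTop]
  intro ε hε
  obtain ⟨δ, hδ, hf⟩ := Metric.uniformContinuous_iff.1
    (CompactSpace.uniformContinuous_of_continuous f.continuous) (ε / 2) (half_pos hε)
  have hp : (p : ℝ)⁻¹ < 1 :=
    inv_lt_one_of_one_lt₀ (by exact_mod_cast (Fact.out : p.Prime).one_lt)
  obtain ⟨N, hN⟩ := eventually_atTop.1 ((tendsto_pow_atTop_nhds_zero_of_lt_one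
    (inv_nonneg.2 (Nat.cast_nonneg p)) hp).eventually_lt_const hδ)
  refine ⟨N, fun n hn => lt_of_le_of_lt ?_ (half_lt_self hε)⟩
  refine (ContinuousMap.dist_le (half_pos hε).le).2 fun x => (hf ?_).le
  refine ((D.cls_eq_iff n _ x).1 (hrep n _)).trans_lt ?_
  rw [zpow_neg, zpow_natCast, ← inv_pow]
  exact hN n hn

end VertexDiscs

end PadicGraph

theorem theorem4p3 {p : ℕ} [Fact p.Prime] {V : Type*} [Fintype V]
    (G : PadicGraph.WeightedGraph V) (D : PadicGraph.VertexDiscs p V)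
    (bullet : PadicGraph.Bullet) (m : PadicGraph.RefMeasure)
    (α : ℝ) (hα : 1 ≤ α) (β : V → ℝ) (hβ : ∀ v, 0 < β v)
    (u₀ : C(D.Z, ℝ)) (u : ℝ → C(D.Z, ℝ))
    (hu : D.IsHeatSolution (D.measure G m) (G.rate α bullet) β u₀ u)
    (rep : ∀ n, D.residues n → D.Z) (hrep : ∀ n a, D.cls n (rep n a) = a)
    (U : ∀ n, ℝ → D.residues n → ℝ)
    (hU : ∀ n, (∀ v, D.level v < n) →
      D.IsHeatSolutionMod (D.measure G m) (G.rate α bullet) β n (D.proj (rep n) u₀) (U n))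
    (τ : ℝ) (hτ : 0 ≤ τ) :
    Tendsto (fun n => ⨆ t ∈ Set.Icc (0 : ℝ) τ, ‖D.embed n (U n t) - u t‖ₑ) atTop (𝓝 0) := by
  have hlim : Tendsto (fun n => ‖D.embed n (D.proj (rep n) u₀) - u₀‖ₑ) atTop (𝓝 0) := by
    simpa only [edist_eq_enorm_sub] using
      tendsto_iff_edist_tendsto_0.1 (D.tendsto_embed_proj u₀ rep hrep)
  refine tendsto_of_tendsto_of_tendsto_of_le_of_le' tendsto_const_nhds hlim
    (Eventually.of_forall fun _ => zero_le) ?_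
  filter_upwards [eventually_all.2 fun v => eventually_gt_atTop (D.level v)] with n hn
  -- The supremum is taken in `ℝ≥0∞`, so no boundedness has to be checked beforehand.
  refine iSup₂_le fun t ht => enorm_le_iff_norm_le.2 ?_
  exact ((hU n hn).embed D hn).norm_sub_le (G.rate_nonneg α bullet) hu ht.1
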